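/- Let $q$ be a prime power, let $\mathbb F_{q^2}$ be the field with $q^2$ elements, let $K$ be its algebraic closure, and let $\mathcal H$ be the affine Hermitian curve defined by $H=x^{q+1}-y^q-y$, with set of $\mathbb F_{q^2}$-rational points $E=\{P_1,\dots,P_n\}$, $n=q^3$. An $\mathbb F_{q^2}$-divisor is a subset $D\subseteq E$ (a sum of pairwise distinct points); its degree is $|D|$. Put $w(x^ry^s)=rq+s(q+1)$, and let the Hermitian code $C_m\subseteq\mathbb F_{q^2}^{\,n}$ be the dual of the code formed by the vectors $(f(P_1),\dots,f(P_n))$, where $f$ runs over the span of the monomials with $w(x^ry^s)\le m$. Let $\Lambda$ be the semigroup generated by $0$, $q$ and $q+1$, let $\mathcal B=\{x^ry^s: 0\le r\le q,\ 0\le s\le q^2-q-1\}\cup\{y^s: q^2-q\le s\le q^2-1\}$, let $\Lambda_{\mathcal B}=\{w(b): b\in\mathcal B\}$, and let $\delta(m)=m-(q-2)(q+1)$. Let $\widetilde m$ be the least integer $m'\ge m$ with $m'+1\in\Lambda_{\mathcal B}$ and $\delta(m')\in\Lambda$, and let $\widetilde\delta_m=\delta(\widetilde m)$. Suppose that $q^2-q-1\le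 m\le 2q^2-2q-3$ and $m=\widetilde m$, and write $\widetilde\delta_m=\mu q+\lambda(q+1)$ with integers $\mu,\lambda\ge 0$. Let $D$ be an $\mathbb F_{q^2}$-divisor of degree $\widetilde\delta_m$. Then $D$ is the support of a minimum-weight codeword of $C_m$ if and only if $D=\mathcal H\cap\mathcal X$ for some curve $\mathcal X$ defined by a polynomial $F\in\mathbb F_{q^2}[x,y]$ whose leading monomial, for the degree reverse lexicographic order with $y>x$, is $x^\mu y^\lambda$. This holds both when $D=\mathcal H\cap\mathcal X$ is read as an equality of schemes (the ideal of all polynomials in $\mathbb F_{q^2}[x,y]$ vanishing on $D$ is $\langle H,F\rangle$) and when it is read as an equality of sets of points of the affine plane over $K$. -/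

import Mathlib

namespace HermitianCode

open MvPolynomial

/-! Throughout, the variable `x` is `X 0`, the variable `y` is `X 1`, and a monomial `x ^ r * y ^ s`
is given by its exponent vector `a : Fin 2 →₀ ℕ` with `a 0 = r` and `a 1 = s`. -/

/-- The polynomial `H = x ^ (q + 1) - y ^ q - y` of the Hermitian curve. -/
noncomputable def hermitianPoly (F : Type*) [Field F] (q : ℕ) : MvPolynomial (Fin 2) F :=
  X 0 ^ (q + 1) - X 1 ^ q - X 1

/-- The set `E` of the affine points of the Hermitian curve with coordinates in `F`. A divisor over
`F` on the curve (a sum of pairwise distinct `F`-rational points) is a `Finset` of such points, and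
its degree is its cardinality. -/
abbrev RatPoint (F : Type*) [Field F] (q : ℕ) : Type _ :=
  {P : Fin 2 → F // eval P (hermitianPoly F q) = 0}

open Classical in
noncomputable instance ratPointFintype (F : Type*) [Field F] [Fintype F] (q : ℕ) :
    Fintype (RatPoint F q) :=
  Subtype.fintype _

/-- The weighted degree `w (x ^ r * y ^ s) = r * q + s * (q + 1)`. -/
def wdeg (q : ℕ) (a : Fin 2 →₀ ℕ) : ℕ := a 0 * q + a 1 * (q + 1)

/-- Evaluation of polynomials at all the points of `E`. -/
noncomputable def evalMap (F : Type*) [Field F] (q : ℕ) :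
    MvPolynomial (Fin 2) F →ₗ[F] (RatPoint F q → F) :=
  LinearMap.pi fun P => (aeval P.1 : MvPolynomial (Fin 2) F →ₐ[F] F).toLinearMap

/-- The space spanned by the monomials of weighted degree less than `m + 1`. Its image under
`evalMap` is the same as that of its image modulo the ideal of `E`. -/
noncomputable def monomialSpace (F : Type*) [Field F] (q m : ℕ) :
    Submodule F (MvPolynomial (Fin 2) F) :=
  Submodule.span F ((fun a => monomial a (1 : F)) '' {a : Fin 2 →₀ ℕ | wdeg q a < m + 1})

/-- The dual of a linear code. -/
def dualCode {F ι : Type*} [Field F] [Fintype ι] (C : Submodule F (ι → F)) :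
    Submodule F (ι → F) where
  carrier := {c | ∀ g ∈ C, g ⬝ᵥ c = 0}
  add_mem' ha hb g hg := by rw [dotProduct_add, ha g hg, hb g hg, add_zero]
  zero_mem' g _ := dotProduct_zero g
  smul_mem' r c hc g hg := by rw [dotProduct_smul, hc g hg, smul_zero]

/-- The Hermitian code `C_m`. -/
noncomputable def code (F : Type*) [Field F] [Fintype F] (q m : ℕ) :
    Submodule F (RatPoint F q → F) :=
  dualCode ((monomialSpace F q m).map (evalMap F q))

open Classical in
/-- `c` is a minimum-weight codeword of `C`: a nonzero codeword whose weight is minimal among the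
weights of the nonzero codewords. -/
def IsMinWeightCodeword {F ι : Type*} [Field F] [Fintype ι] (C : Submodule F (ι → F))
    (c : ι → F) : Prop :=
  c ∈ C ∧ c ≠ 0 ∧ ∀ c' ∈ C, c' ≠ 0 → hammingNorm c ≤ hammingNorm c'

/-- `D` is the support of a minimum-weight codeword of `C`. -/
def SupportsMinWeight {F ι : Type*} [Field F] [Fintype ι] (C : Submodule F (ι → F))
    (D : Finset ι) : Prop :=
  ∃ c : ι → F, IsMinWeightCodeword C c ∧ Function.support c = (D : Set ι)

/-- The semigroup `Λ` generated by `q` and `q + 1`. -/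
def semigroup (q : ℕ) : AddSubmonoid ℕ := AddSubmonoid.closure {q, q + 1}

/-- The set `𝓑` of the monomials `x ^ r * y ^ s` with `r ≤ q` and `s ≤ q ^ 2 - q - 1`, together
with the monomials `y ^ s` with `q ^ 2 - q ≤ s ≤ q ^ 2 - 1`. -/
def basisMonomials (q : ℕ) : Set (Fin 2 →₀ ℕ) :=
  {a | a 0 ≤ q ∧ a 1 < q ^ 2 - q} ∪ {a | a 0 = 0 ∧ q ^ 2 - q ≤ a 1 ∧ a 1 < q ^ 2}

/-- The set `Λ_𝓑` of the weighted degrees of the monomials in `𝓑`. -/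
def basisWeights (q : ℕ) : Set ℕ := wdeg q '' basisMonomials q

/-- `δ(m) = m - (q - 2) * (q + 1)`. -/
def delta (q m : ℕ) : ℤ := m - (q - 2) * (q + 1)

/-- The least integer `m' ≥ m` such that `m' + 1 ∈ Λ_𝓑` and `δ(m') ∈ Λ`. -/
noncomputable def mTilde (q m : ℕ) : ℕ :=
  sInf {m' | m ≤ m' ∧ m' + 1 ∈ basisWeights q ∧ ∃ s ∈ semigroup q, (s : ℤ) = delta q m'}

/-- `δ` evaluated at `mTilde q m`. -/
noncomputable def deltaTilde (q m : ℕ) : ℤ := delta q (mTilde q m)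

/-- The degree reverse lexicographic order with `y > x`, on exponent vectors: `a` is smaller than
`b` if its total degree is smaller, or if the total degrees agree and the exponent of the smallest
variable `x` is larger in `a` than in `b`. (In two variables, distinct monomials of the same degree
have distinct exponents of `x`.) -/
def DegRevLexLT (a b : Fin 2 →₀ ℕ) : Prop :=
  a 0 + a 1 < b 0 + b 1 ∨ (a 0 + a 1 = b 0 + b 1 ∧ b 0 < a 0)

/-- `x ^ r * y ^ s` is the leading monomial of `f` for `DegRevLexLT`. -/
def HasLeadingMonomial {F : Type*} [Field F] (f : MvPolynomial (Fin 2) F) (r s : ℕ) : Prop :=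
  ∃ a ∈ f.support, a 0 = r ∧ a 1 = s ∧ ∀ b ∈ f.support, b ≠ a → DegRevLexLT b a

/-- The points of the divisor `D` in the affine plane over `F`. -/
def planePoints {F : Type*} [Field F] {q : ℕ} (D : Finset (RatPoint F q)) : Set (Fin 2 → F) :=
  Subtype.val '' (D : Set (RatPoint F q))

/-- `D` is the scheme-theoretic intersection of the Hermitian curve and the curve `f = 0`: the ideal
of all polynomials vanishing on `D` is generated by `H` and `f`. -/
def IsSchemeIntersection {F : Type*} [Field F] {q : ℕ} (D : Finset (RatPoint F q))
    (f : MvPolynomial (Fin 2) F) : Prop :=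
  vanishingIdeal F (planePoints D) = Ideal.span {hermitianPoly F q, f}

/-- `D` is the set of the common points of the Hermitian curve and the curve `f = 0` in the affine
plane over the algebraic closure of `F`. -/
def IsSetIntersection {F : Type*} [Field F] {q : ℕ} (D : Finset (RatPoint F q))
    (f : MvPolynomial (Fin 2) F) : Prop :=
  (fun P i => algebraMap F (AlgebraicClosure F) (P i)) '' planePoints D =
    {Q : Fin 2 → AlgebraicClosure F | aeval Q (hermitianPoly F q) = 0 ∧ aeval Q f = 0}

end HermitianCode

/-! Filter the polynomials by weighted degree and restrict them to the points of D. Modulo H and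
lower terms all monomials of one weight agree, so each weight adds at most one dimension to the
space of values. The weights where it grows, the jumps, lie in Λ and number |D|. Multiplying by
monomials shows that if a sum of two elements of Λ is a jump, so is each summand (`IsJump.of_add`).

By duality, D contains the support of a nonzero codeword iff the values of polynomials of weight at
most m do not fill F^D (`exists_codeword_iff`), hence iff some jump a exceeds m. The symmetry of Λ,
with Frobenius number q(q-1)-1, then makes all of Λ \ (e'+Λ) jumps, where e' = a+1-q(q-1). This set
has at least e' elements, so |D| ≥ e' ≥ e = m+2-q(q-1), which is δ(m).

If |D| = e, the jumps are exactly Λ \ (e+Λ). The non-jump e = μq+ν(q+1) yields a polynomial f with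
leading monomial x^μ y^ν vanishing on D, and division by f and H generates the whole ideal.
Conversely, such an f excludes e+Λ from the jumps; counting makes the remaining weights all jumps,
among them m+1 = e+q(q-1)-1. Since e < q(q-1), the weight and the monomial order agree where needed.
-/

namespace HermitianCode

open MvPolynomial

/-! ### The numerical semigroup generated by `q` and `q + 1` -/

/-- The numbers of the form `r * q + s * (q + 1)`, described by division with remainder. -/
def IsWeight (q n : ℕ) : Prop := n % q ≤ n / q

instance (q n : ℕ) : Decidable (IsWeight q n) := inferInstanceAs (Decidable (_ ≤ _))

theorem isWeight_mul_add {q k s : ℕ} (hq : 2 ≤ q) (hs : s ≤ k) : IsWeight q (k * q + s) := by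
  unfold IsWeight
  have h1 : (k * q + s) / q = s / q + k := by
    rw [add_comm, Nat.add_mul_div_right _ _ (by omega)]
  have h2 : (k * q + s) % q = s % q := by
    rw [add_comm, Nat.add_mul_mod_self_right]
  rw [h1, h2]
  exact ((Nat.mod_le s q).trans hs).trans (Nat.le_add_left _ _)

theorem isWeight_wdeg {q : ℕ} (hq : 2 ≤ q) (a : Fin 2 →₀ ℕ) : IsWeight q (wdeg q a) := by
  have : wdeg q a = (a 0 + a 1) * q + a 1 := by unfold wdeg; ring
  rw [this]
  exact isWeight_mul_add hq (by omega)

theorem wdeg_add (q : ℕ) (a b : Fin 2 →₀ ℕ) : wdeg q (a + b) = wdeg q a + wdeg q b := by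
  simp only [wdeg, Finsupp.add_apply]; ring

/-- The exponent vector of `x ^ r * y ^ s`. -/
noncomputable def expVec (r s : ℕ) : Fin 2 →₀ ℕ := Finsupp.equivFunOnFinite.symm ![r, s]

@[simp] theorem expVec_zero (r s : ℕ) : expVec r s 0 = r := rfl

@[simp] theorem expVec_one (r s : ℕ) : expVec r s 1 = s := rfl

theorem eq_expVec (a : Fin 2 →₀ ℕ) : a = expVec (a 0) (a 1) := by
  ext i; fin_cases i <;> rfl

theorem IsWeight.exists_wdeg {q n : ℕ} (h : IsWeight q n) : ∃ a, wdeg q a = n := by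
  unfold IsWeight at h
  refine ⟨expVec (n / q - n % q) (n % q), ?_⟩
  obtain ⟨d, hd⟩ := Nat.exists_eq_add_of_le h
  have := Nat.div_add_mod n q
  simp only [wdeg, expVec_zero, expVec_one]
  rw [hd] at this ⊢
  rw [Nat.add_sub_cancel_left]
  linarith

theorem isWeight_of_conductor_le {q n : ℕ} (hq : 2 ≤ q) (h : q * (q - 1) ≤ n) :
    IsWeight q n := by
  unfold IsWeight
  have h1 : q - 1 ≤ n / q := (Nat.le_div_iff_mul_le (by omega)).2 (by rwa [mul_comm])
  have h2 := Nat.mod_lt n (show q > 0 by omega)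
  omega

/-- Symmetry of Λ: reflection in the Frobenius number sends gaps into Λ. For a gap k = uq+j put j =
u+t+1 and q = j+v+1; the reflected number is (v+t)q+v. -/
theorem isWeight_symm {q k : ℕ} (hq : 2 ≤ q) (h : ¬ IsWeight q k) :
    k < q * (q - 1) ∧ IsWeight q (q * (q - 1) - 1 - k) := by
  have hk : k < q * (q - 1) := by
    by_contra hc
    exact h (isWeight_of_conductor_le hq (not_lt.1 hc))
  refine ⟨hk, ?_⟩
  unfold IsWeight at h
  push Not at h
  have h3 := Nat.div_add_mod k q
  have h2 := Nat.mod_lt k (show q > 0 by omega)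
  obtain ⟨t, ht⟩ := Nat.exists_eq_add_of_lt h
  obtain ⟨v, hv⟩ := Nat.exists_eq_add_of_lt h2
  generalize k / q = u at *
  generalize k % q = j at *
  have : q * (q - 1) - 1 - k = (v + t) * q + v := by
    have e : q - 1 = u + t + 1 + v := by omega
    rw [e, ← h3]
    have : q * (u + t + 1 + v) = (q * u + j) + 1 + ((v + t) * q + v) := by
      have : q = j + v + 1 := by omega
      nlinarith
    omega
  rw [this]
  exact isWeight_mul_add hq (by omega)

theorem not_isWeight_frobenius {q : ℕ} (hq : 2 ≤ q) : ¬ IsWeight q (q * (q - 1) - 1) := by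
  obtain ⟨t, rfl⟩ := Nat.exists_eq_add_of_le hq
  have : (2 + t) * (2 + t - 1) - 1 = (t + 1) + t * (2 + t) := by
    rw [show 2 + t - 1 = t + 1 by omega]
    have : (2 + t) * (t + 1) = (t + 1) + t * (2 + t) + 1 := by ring
    omega
  unfold IsWeight
  rw [this, Nat.add_mul_div_right _ _ (by omega), Nat.add_mul_mod_self_right,
    Nat.mod_eq_of_lt (by omega), Nat.div_eq_of_lt (by omega)]
  omega

/-- The elements of the semigroup that are not in its translate by `e`. -/
def aperySet (q e : ℕ) : Finset ℕ :=
  (Finset.range (e + q * (q - 1))).filter fun n => IsWeight q n ∧ ¬ (e ≤ n ∧ IsWeight q (n - e))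

theorem mem_aperySet {q e n : ℕ} (hq : 2 ≤ q) :
    n ∈ aperySet q e ↔ IsWeight q n ∧ ¬ (e ≤ n ∧ IsWeight q (n - e)) := by
  simp only [aperySet, Finset.mem_filter, Finset.mem_range, and_iff_right_iff_imp]
  rintro ⟨_, h⟩
  by_contra hc
  exact h ⟨by omega, isWeight_of_conductor_le hq (by omega)⟩

/-- For n ≥ e the number n-e is a gap and a-n is its reflection; for n < e, a-n is past the
conductor. -/
theorem isWeight_sub_of_mem_aperySet {q e a n : ℕ} (hq : 2 ≤ q) (ha : a + 1 = e + q * (q - 1))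
    (hn : n ∈ aperySet q e) : n ≤ a ∧ IsWeight q (a - n) := by
  obtain ⟨-, h⟩ := (mem_aperySet hq).1 hn
  by_cases he : e ≤ n
  · have h' : ¬ IsWeight q (n - e) := fun h' => h ⟨he, h'⟩
    obtain ⟨h1, h2⟩ := isWeight_symm hq h'
    refine ⟨by omega, ?_⟩
    rwa [show a - n = q * (q - 1) - 1 - (n - e) by omega]
  · exact ⟨by omega, isWeight_of_conductor_le hq (by omega)⟩

theorem card_isWeight_range {q : ℕ} (hq : 2 ≤ q) (e : ℕ) :
    ((Finset.range (e + q * (q - 1))).filter (IsWeight q)).card =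
      e + ((Finset.range (q * (q - 1))).filter (IsWeight q)).card := by
  induction e with
  | zero => simp
  | succ e ih =>
    rw [show e + 1 + q * (q - 1) = (e + q * (q - 1)) + 1 by ring, Finset.range_add_one,
      Finset.filter_insert, if_pos (isWeight_of_conductor_le hq (by omega)),
      Finset.card_insert_of_notMem (by simp), ih]
    ring

theorem aperySet_eq_sdiff (q e : ℕ) : aperySet q e =
    (Finset.range (e + q * (q - 1))).filter (IsWeight q) \
      ((Finset.range (q * (q - 1))).filter (IsWeight q)).map (addLeftEmbedding e) := by
  ext n
  simp only [aperySet, Finset.mem_filter, Finset.mem_sdiff, Finset.mem_range, Finset.mem_map,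
    addLeftEmbedding_apply, and_assoc]
  refine and_congr_right fun h1 => and_congr_right fun _ => not_congr ⟨fun ⟨h2, h3⟩ => ?_, ?_⟩
  · exact ⟨n - e, by omega, h3, by omega⟩
  · rintro ⟨k, -, h3, rfl⟩
    exact ⟨by omega, by rwa [Nat.add_sub_cancel_left]⟩

/-- No condition on e is needed: past the conductor every integer lies in Λ, and removing the
translate costs at most its size. Equality holds once e ∈ Λ, as the translate then lies inside Λ. -/
theorem le_card_aperySet {q : ℕ} (hq : 2 ≤ q) (e : ℕ) : e ≤ (aperySet q e).card := by
  rw [aperySet_eq_sdiff]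
  refine le_trans ?_ (Finset.le_card_sdiff _ _)
  rw [Finset.card_map, card_isWeight_range hq]
  omega

theorem IsWeight.add {q m n : ℕ} (hq : 2 ≤ q) (hm : IsWeight q m) (hn : IsWeight q n) :
    IsWeight q (m + n) := by
  obtain ⟨a, rfl⟩ := hm.exists_wdeg
  obtain ⟨b, rfl⟩ := hn.exists_wdeg
  rw [← wdeg_add]
  exact isWeight_wdeg hq _

theorem card_aperySet {q e : ℕ} (hq : 2 ≤ q) (he : IsWeight q e) :
    (aperySet q e).card = e := by
  rw [aperySet_eq_sdiff, Finset.card_sdiff_of_subset, Finset.card_map, card_isWeight_range hq]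
  · omega
  · intro n hn
    simp only [Finset.mem_filter, Finset.mem_range, Finset.mem_map,
      addLeftEmbedding_apply] at hn ⊢
    obtain ⟨k, ⟨h1, h2⟩, rfl⟩ := hn
    exact ⟨by omega, he.add hq h2⟩

/-! ### The filtration by weighted degree -/

/-- The space spanned by the monomials of weighted degree less than `n`. -/
noncomputable def weightLT (F : Type*) [Field F] (q n : ℕ) :
    Submodule F (MvPolynomial (Fin 2) F) :=
  Submodule.span F ((fun a => monomial a (1 : F)) '' {a : Fin 2 →₀ ℕ | wdeg q a < n})

section Filtration

variable {F : Type*} [Field F] {q : ℕ}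

theorem mem_weightLT {n : ℕ} {p : MvPolynomial (Fin 2) F} :
    p ∈ weightLT F q n ↔ ∀ a ∈ p.support, wdeg q a < n := by
  have h : weightLT F q n = restrictSupport F {a : Fin 2 →₀ ℕ | wdeg q a < n} :=
    (restrictSupport_eq_span F _).symm
  rw [h, mem_restrictSupport_iff]
  rfl

theorem weightLT_mono {m n : ℕ} (h : m ≤ n) : weightLT F q m ≤ weightLT F q n :=
  fun _ hp => mem_weightLT.2 fun a ha => (mem_weightLT.1 hp a ha).trans_le h

theorem monomial_mem_weightLT {n : ℕ} {a : Fin 2 →₀ ℕ} (h : wdeg q a < n) (c : F) :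
    monomial a c ∈ weightLT F q n := by
  rw [mem_weightLT]
  intro b hb
  rw [Finset.mem_singleton.1 (support_monomial_subset hb)]
  exact h

theorem monomial_mul_mem_weightLT {n : ℕ} {p : MvPolynomial (Fin 2) F} (hp : p ∈ weightLT F q n)
    (b : Fin 2 →₀ ℕ) (c : F) : monomial b c * p ∈ weightLT F q (n + wdeg q b) := by
  classical
  rw [mem_weightLT] at hp ⊢
  intro a ha
  obtain ⟨u, hu, v, hv, rfl⟩ := Finset.mem_add.1 (support_mul _ _ ha)
  rw [Finset.mem_singleton.1 (support_monomial_subset hu), wdeg_add]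
  have := hp v hv
  omega

theorem exists_mem_weightLT (p : MvPolynomial (Fin 2) F) : ∃ n, p ∈ weightLT F q n := by
  refine ⟨p.support.sup (wdeg q) + 1, mem_weightLT.2 fun a ha => ?_⟩
  exact Nat.lt_succ_of_le (Finset.le_sup (f := wdeg q) ha)

/-- A monomial can be traded for another one of the same weight, up to terms of smaller weight and
multiples of `H`. -/
theorem exists_expVec_sub_mem (r s k : ℕ) (n : ℕ) (hq : 2 ≤ q)
    (hn : wdeg q (expVec r (s + k * q)) = n) :
    ∃ h : MvPolynomial (Fin 2) F,
      monomial (expVec (r + k * (q + 1)) s) 1 - monomial (expVec r (s + k * q)) 1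
        - hermitianPoly F q * h ∈ weightLT F q n := by
  induction k generalizing s with
  | zero => exact ⟨0, by simp⟩
  | succ k ih =>
    obtain ⟨h, hh⟩ := ih (s + q) (by rw [← hn]; congr 2; ring)
    have hX : ∀ r s : ℕ, (monomial (expVec r s) 1 : MvPolynomial (Fin 2) F) = X 0 ^ r * X 1 ^ s := by
      intro r s
      rw [monomial_eq]
      simp [Finsupp.prod_fintype, Fin.prod_univ_two]
    -- One use of x^(q+1) = H + y^q + y; the stray y has smaller weight than y^q.
    refine ⟨h + monomial (expVec (r + k * (q + 1)) s) 1, ?_⟩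
    have key : (monomial (expVec (r + (k + 1) * (q + 1)) s) 1
        - monomial (expVec r (s + (k + 1) * q)) 1
        - hermitianPoly F q * (h + monomial (expVec (r + k * (q + 1)) s) 1) :
          MvPolynomial (Fin 2) F) =
        (monomial (expVec (r + k * (q + 1)) (s + q)) 1 - monomial (expVec r (s + q + k * q)) 1
          - hermitianPoly F q * h) + monomial (expVec (r + k * (q + 1)) (s + 1)) 1 := by
      simp only [hX, hermitianPoly]
      ring
    rw [key]
    refine add_mem hh (monomial_mem_weightLT ?_ _)
    rw [← hn]
    simp only [wdeg, expVec_zero, expVec_one]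
    have : q + 1 < q * (q + 1) := by nlinarith
    linarith

/-- As q and q+1 are coprime, exponents of equal weight differ by a multiple of (q+1, -q). -/
theorem exists_monomial_sub_mem (hq : 2 ≤ q) {a b : Fin 2 →₀ ℕ} (hab : wdeg q a = wdeg q b) :
    ∃ h : MvPolynomial (Fin 2) F,
      monomial a 1 - monomial b 1 - hermitianPoly F q * h ∈ weightLT F q (wdeg q b) := by
  wlog hle : b 0 ≤ a 0 generalizing a b
  · obtain ⟨h, hh⟩ := this hab.symm (by omega)
    refine ⟨-h, ?_⟩
    rw [← hab]
    convert neg_mem hh using 1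
    ring
  obtain ⟨d, hd⟩ := Nat.exists_eq_add_of_le hle
  have h1 : d * q + a 1 * (q + 1) = b 1 * (q + 1) := by
    unfold wdeg at hab
    rw [hd] at hab
    linarith
  have h2 : a 1 ≤ b 1 := by nlinarith
  obtain ⟨e, he⟩ := Nat.exists_eq_add_of_le h2
  have h3 : d * q = e * (q + 1) := by rw [he] at h1; linarith
  have h4 : (q + 1) ∣ d :=
    Nat.Coprime.dvd_of_dvd_mul_right (by rw [Nat.coprime_comm, Nat.coprime_self_add_right]; exact Nat.coprime_one_right q) ⟨e, by rw [h3]; ring⟩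
  obtain ⟨k, rfl⟩ := h4
  have h5 : e = k * q := by
    have : (q + 1) * e = (q + 1) * (k * q) := by linarith
    exact Nat.eq_of_mul_eq_mul_left (by omega) this
  have ea : a = expVec (b 0 + k * (q + 1)) (a 1) := by
    rw [mul_comm k, ← hd, ← eq_expVec]
  have eb : b = expVec (b 0) (a 1 + k * q) := by
    conv_lhs => rw [eq_expVec b, he, h5]
  have := exists_expVec_sub_mem (F := F) (b 0) (a 1) k (wdeg q b) hq (by rw [← eb])
  rwa [← ea, ← eb] at this

/-- A polynomial of weight at most `wdeg q b` is, up to terms of smaller weight and multiples of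
`H`, a scalar multiple of the monomial with exponent `b`. -/
theorem exists_sub_mem_weightLT (hq : 2 ≤ q) (b : Fin 2 →₀ ℕ) {p : MvPolynomial (Fin 2) F}
    (hp : p ∈ weightLT F q (wdeg q b + 1)) :
    ∃ (c : F) (h : MvPolynomial (Fin 2) F),
      p - monomial b c - hermitianPoly F q * h ∈ weightLT F q (wdeg q b) := by
  unfold weightLT at hp
  induction hp using Submodule.span_induction with
  | mem x hx =>
    obtain ⟨a, ha, rfl⟩ := hx
    rcases Nat.lt_succ_iff_lt_or_eq.1 ha with h | h
    · exact ⟨0, 0, by simpa using monomial_mem_weightLT h 1⟩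
    · obtain ⟨h', hh⟩ := exists_monomial_sub_mem (F := F) hq h
      exact ⟨1, h', hh⟩
  | zero => exact ⟨0, 0, by simp⟩
  | add x y _ _ hx hy =>
    obtain ⟨c, h, hc⟩ := hx
    obtain ⟨c', h', hc'⟩ := hy
    refine ⟨c + c', h + h', ?_⟩
    convert add_mem hc hc' using 1
    rw [map_add]
    ring
  | smul t x _ hx =>
    obtain ⟨c, h, hc⟩ := hx
    refine ⟨t * c, t • h, ?_⟩
    convert Submodule.smul_mem _ t hc using 1
    rw [smul_sub, smul_sub, smul_monomial, smul_eq_mul, mul_smul_comm]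

theorem weightLT_succ_of_not_isWeight {n : ℕ} (hq : 2 ≤ q) (h : ¬ IsWeight q n) :
    weightLT F q (n + 1) = weightLT F q n := by
  refine le_antisymm (fun p hp => mem_weightLT.2 fun a ha => ?_) (weightLT_mono n.le_succ)
  refine (Nat.lt_succ_iff_lt_or_eq.1 (mem_weightLT.1 hp a ha)).resolve_right ?_
  rintro rfl
  exact h (isWeight_wdeg hq a)

/-! ### Evaluation at finitely many points of the curve -/

variable {ι : Type*} (P : ι → Fin 2 → F)

/-- Evaluation at a family of points. -/
noncomputable def evalAt : MvPolynomial (Fin 2) F →ₐ[F] (ι → F) :=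
  AlgHom.pi fun i => aeval (P i)

@[simp] theorem evalAt_apply (p : MvPolynomial (Fin 2) F) (i : ι) :
    evalAt P p i = eval (P i) p := by
  simp [evalAt, aeval_eq_eval]

/-- The values of the polynomials of weight less than `n` at a family of points. -/
noncomputable def valueSpace (q n : ℕ) : Submodule F (ι → F) :=
  (weightLT F q n).map (evalAt P).toLinearMap

theorem valueSpace_mono {m n : ℕ} (h : m ≤ n) : valueSpace P q m ≤ valueSpace P q n :=
  Submodule.map_mono (weightLT_mono h)

variable (q) in
/-- The weights at which the space of values grows. -/
def IsJump (n : ℕ) : Prop := valueSpace P q n ≠ valueSpace P q (n + 1)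

variable {P}

theorem IsJump.isWeight {n : ℕ} (hq : 2 ≤ q) (h : IsJump q P n) : IsWeight q n := by
  by_contra hc
  exact h (by rw [valueSpace, valueSpace, weightLT_succ_of_not_isWeight hq hc])

variable (hP : ∀ i, eval (P i) (hermitianPoly F q) = 0)

include hP

theorem valueSpace_succ_wdeg (hq : 2 ≤ q) (b : Fin 2 →₀ ℕ) :
    valueSpace P q (wdeg q b + 1) =
      valueSpace P q (wdeg q b) ⊔ Submodule.span F {evalAt P (monomial b 1)} := by
  refine le_antisymm ?_ (sup_le (valueSpace_mono P (Nat.le_succ _)) ?_)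
  · rintro _ ⟨p, hp, rfl⟩
    obtain ⟨c, h, hc⟩ := exists_sub_mem_weightLT hq b hp
    rw [Submodule.mem_sup]
    refine ⟨_, ⟨_, hc, rfl⟩, c • evalAt P (monomial b 1),
      Submodule.smul_mem _ _ (Submodule.mem_span_singleton_self _), ?_⟩
    ext i
    simp [eval_monomial, hP i]
  · rw [Submodule.span_singleton_le_iff_mem]
    exact ⟨_, monomial_mem_weightLT (Nat.lt_succ_self _) 1, rfl⟩

theorem isJump_wdeg_iff (hq : 2 ≤ q) (b : Fin 2 →₀ ℕ) :
    IsJump q P (wdeg q b) ↔ evalAt P (monomial b 1) ∉ valueSpace P q (wdeg q b) := by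
  rw [IsJump, valueSpace_succ_wdeg hP hq, ne_comm, ne_eq, sup_eq_left,
    Submodule.span_singleton_le_iff_mem]

/-- If a monomial of weight m has the values of a lower-weight polynomial, multiplying by a monomial
of weight n gives the same at m+n. -/
theorem IsJump.of_add {m n : ℕ} (hq : 2 ≤ q) (h : IsJump q P (m + n)) (hm : IsWeight q m)
    (hn : IsWeight q n) : IsJump q P m := by
  obtain ⟨a, rfl⟩ := hm.exists_wdeg
  obtain ⟨b, rfl⟩ := hn.exists_wdeg
  rw [isJump_wdeg_iff hP hq]
  rintro ⟨p, hp, hpa⟩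
  rw [← wdeg_add, isJump_wdeg_iff hP hq] at h
  refine h ⟨monomial b 1 * p, ?_, ?_⟩
  · rw [wdeg_add]
    exact monomial_mul_mem_weightLT hp b 1
  · simp only [AlgHom.toLinearMap_apply] at hpa ⊢
    rw [map_mul, hpa, ← map_mul, monomial_mul, one_mul, add_comm]

variable [Fintype ι]

open Classical in
theorem finrank_valueSpace (hq : 2 ≤ q) (n : ℕ) :
    Module.finrank F (valueSpace P q n) = ((Finset.range n).filter (IsJump q P)).card := by
  induction n with
  | zero =>
    have : valueSpace P q 0 = ⊥ := by
      rw [valueSpace, weightLT]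
      simp
    simp [this]
  | succ n ih =>
    rw [Finset.range_add_one, Finset.filter_insert]
    split_ifs with h
    · rw [Finset.card_insert_of_notMem (by simp), ← ih]
      obtain ⟨b, rfl⟩ := (h.isWeight hq).exists_wdeg
      have hb := (isJump_wdeg_iff hP hq b).1 h
      rw [valueSpace_succ_wdeg hP hq]
      exact Submodule.finrank_sup_span_singleton hb
    · rw [← ih, ← not_not.1 h]

open Classical in
theorem card_jumps_le (hq : 2 ≤ q) (n : ℕ) :
    ((Finset.range n).filter (IsJump q P)).card ≤ Fintype.card ι := by
  rw [← finrank_valueSpace hP hq]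
  exact (Submodule.finrank_le _).trans (Module.finrank_fintype_fun_eq_card F).le

omit [Fintype ι] in
open Classical in
theorem aperySet_subset_jumps {a e : ℕ} (hq : 2 ≤ q) (ha : a + 1 = e + q * (q - 1))
    (h : IsJump q P a) : aperySet q e ⊆ (Finset.range (a + 1)).filter (IsJump q P) := by
  intro n hn
  obtain ⟨h1, h2⟩ := isWeight_sub_of_mem_aperySet hq ha hn
  rw [Finset.mem_filter, Finset.mem_range]
  refine ⟨by omega, IsJump.of_add hP hq ?_ ((mem_aperySet hq).1 hn).1 h2⟩
  rwa [Nat.add_sub_cancel' h1]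

omit hP in
theorem exists_valueSpace_eq_top (hinj : Function.Injective P) :
    ∃ N, valueSpace P q N = ⊤ := by
  classical
  have key : ∀ i, ∃ p : MvPolynomial (Fin 2) F, evalAt P p = Pi.single i 1 := by
    intro i
    have : ∀ j, j ≠ i → ∃ k, P i k ≠ P j k := fun j hj => by
      by_contra! hc
      exact hj (hinj (funext hc)).symm
    choose! k hk using this
    -- Lagrange interpolation: each factor separates one other point from `P i`.
    set g : MvPolynomial (Fin 2) F := ∏ j ∈ Finset.univ.erase i, (X (k j) - C (P j (k j))) with hg
    have h0 : eval (P i) g ≠ 0 := by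
      rw [hg, map_prod]
      refine Finset.prod_ne_zero_iff.2 fun j hj => ?_
      simpa [sub_eq_zero] using hk j (Finset.ne_of_mem_erase hj)
    refine ⟨C (eval (P i) g)⁻¹ * g, funext fun j => ?_⟩
    rw [evalAt_apply, map_mul, eval_C]
    by_cases hj : j = i
    · subst hj
      simp [h0]
    · have : eval (P j) g = 0 := by
        rw [hg, map_prod]
        exact Finset.prod_eq_zero (Finset.mem_erase.2 ⟨hj, Finset.mem_univ j⟩) (by simp)
      simp [this, hj]
  choose p hp using key
  choose n hn using fun i => exists_mem_weightLT (q := q) (p i)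
  refine ⟨Finset.univ.sup n, ?_⟩
  rw [eq_top_iff, ← (Pi.basisFun F ι).span_eq, Submodule.span_le]
  rintro _ ⟨i, rfl⟩
  rw [Pi.basisFun_apply, ← hp i]
  exact ⟨p i, weightLT_mono (Finset.le_sup (Finset.mem_univ i)) (hn i), rfl⟩

omit hP in
theorem exists_isJump_of_ne_top (hinj : Function.Injective P) {m : ℕ}
    (h : valueSpace P q m ≠ ⊤) : ∃ a, m ≤ a ∧ IsJump q P a := by
  by_contra! hc
  obtain ⟨N, hN⟩ := exists_valueSpace_eq_top (q := q) hinj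
  have key : ∀ k, valueSpace P q (m + k) = valueSpace P q m := by
    intro k
    induction k with
    | zero => rfl
    | succ k ih => rw [← ih]; exact (not_not.1 (hc (m + k) (by omega))).symm
  refine h (top_le_iff.1 ?_)
  rw [← hN, ← key N]
  exact valueSpace_mono P (Nat.le_add_left _ _)

/-- The Goppa bound. -/
theorem le_card_of_valueSpace_ne_top (hq : 2 ≤ q) (hinj : Function.Injective P) {m e : ℕ}
    (he : m + 2 = e + q * (q - 1)) (h : valueSpace P q (m + 1) ≠ ⊤) : e ≤ Fintype.card ι := by
  obtain ⟨a, ha, hj⟩ := exists_isJump_of_ne_top hinj h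
  have h1 : a + 1 = (a + 1 - q * (q - 1)) + q * (q - 1) := by omega
  have := (le_card_aperySet hq _).trans ((Finset.card_le_card
    (aperySet_subset_jumps hP hq h1 hj)).trans (card_jumps_le hP hq _))
  omega

/-- In the case of equality in the Goppa bound, the jumps are known. -/
theorem isJump_iff_of_valueSpace_ne_top (hq : 2 ≤ q) (hinj : Function.Injective P) {m e : ℕ}
    (he : m + 2 = e + q * (q - 1)) (h : valueSpace P q (m + 1) ≠ ⊤) (hc : Fintype.card ι = e)
    (n : ℕ) : IsJump q P n ↔ n ∈ aperySet q e := by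
  classical
  obtain ⟨a, ha, hj⟩ := exists_isJump_of_ne_top hinj h
  have h1 : a + 1 = (a + 1 - q * (q - 1)) + q * (q - 1) := by omega
  have h2 := aperySet_subset_jumps hP hq h1 hj
  have h3 := (le_card_aperySet hq _).trans ((Finset.card_le_card h2).trans (card_jumps_le hP hq _))
  -- Equality in the bound forces a = m+1.
  rw [show a + 1 - q * (q - 1) = e by omega] at h2
  -- The range is enlarged to contain the arbitrary n; the bound on the number of jumps is uniform.
  have h4 : aperySet q e ⊆ (Finset.range (a + 1 + (n + 1))).filter (IsJump q P) :=
    h2.trans (Finset.filter_subset_filter _ (Finset.range_mono (by omega)))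
  have h5 := Finset.eq_of_subset_of_card_le h4
    ((card_jumps_le hP hq _).trans (hc.le.trans (le_card_aperySet hq e)))
  rw [h5, Finset.mem_filter, Finset.mem_range]
  exact ⟨fun h => ⟨by omega, h⟩, fun h => h.2⟩

theorem valueSpace_ne_top_of_jumps (hq : 2 ≤ q) (hinj : Function.Injective P) {m e : ℕ}
    (he : m + 2 = e + q * (q - 1)) (hw : IsWeight q e) (he0 : 0 < e) (hc : Fintype.card ι = e)
    (h : ∀ n, IsJump q P n → n ∈ aperySet q e) : valueSpace P q (m + 1) ≠ ⊤ := by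
  classical
  obtain ⟨N, hN⟩ := exists_valueSpace_eq_top (q := q) hinj
  have h1 : (Finset.range N).filter (IsJump q P) ⊆ aperySet q e :=
    fun n hn => h n (Finset.mem_filter.1 hn).2
  have h2 : ((Finset.range N).filter (IsJump q P)).card = e := by
    rw [← finrank_valueSpace hP hq, hN, finrank_top, Module.finrank_fintype_fun_eq_card, hc]
  have h3 := Finset.eq_of_subset_of_card_le h1 (by rw [h2, card_aperySet hq hw])
  -- m+1-e is the Frobenius number, a gap.
  have h4 : m + 1 ∈ aperySet q e := by
    rw [mem_aperySet hq]
    refine ⟨isWeight_of_conductor_le hq (by omega), fun h => not_isWeight_frobenius hq ?_⟩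
    rw [show q * (q - 1) - 1 = m + 1 - e by omega]
    exact h.2
  rw [← h3, Finset.mem_filter] at h4
  intro ht
  refine h4.2 (ht.trans (top_le_iff.1 ?_).symm)
  rw [← ht]
  exact valueSpace_mono P (Nat.le_succ _)

end Filtration

/-! ### Jumps and the polynomial with leading monomial x^μ y^ν -/

section LeadingMonomial

variable {F : Type*} [Field F] {q μ ν : ℕ}

/-- Below the weight `q * (q - 1)` the weighted degree refines the degree reverse lexicographic
order. -/
theorem wdeg_lt_of_degRevLexLT (h : μ * q + ν * (q + 1) < q * (q - 1)) {b : Fin 2 →₀ ℕ}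
    (hb : DegRevLexLT b (expVec μ ν)) : wdeg q b < μ * q + ν * (q + 1) := by
  simp only [DegRevLexLT, expVec_zero, expVec_one] at hb
  unfold wdeg
  -- Weight is q times total degree plus the y-exponent; with y-exponents below q it compares
  -- degrees first, then y-exponents.
  have h1 : μ + ν < q - 1 := by
    by_contra hc
    have := Nat.mul_le_mul_left q (not_lt.1 hc)
    nlinarith
  rcases hb with hb | ⟨hb, hb'⟩
  · have := Nat.mul_le_mul_left q (Nat.succ_le_of_lt hb)
    have : b 1 < q := by omega
    nlinarith
  · obtain ⟨d, hd⟩ := Nat.exists_eq_add_of_lt hb'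
    have : ν = b 1 + d + 1 := by omega
    subst this
    rw [hd]
    nlinarith

theorem degRevLexLT_of_wdeg_lt (h : μ * q + ν * (q + 1) < q * (q - 1)) {b : Fin 2 →₀ ℕ}
    (hb : wdeg q b < μ * q + ν * (q + 1)) : DegRevLexLT b (expVec μ ν) := by
  simp only [DegRevLexLT, expVec_zero, expVec_one]
  unfold wdeg at hb
  have h1 : μ + ν < q - 1 := by
    by_contra hc
    have := Nat.mul_le_mul_left q (not_lt.1 hc)
    nlinarith
  by_contra! hc
  obtain ⟨hc1, hc2⟩ := hc
  rcases Nat.lt_or_eq_of_le hc1 with hlt | heq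
  · have := Nat.mul_le_mul_left q (Nat.succ_le_of_lt hlt)
    have : ν < q := by omega
    nlinarith
  · have h3 := hc2 heq.symm
    have h4 : ν ≤ b 1 := by omega
    have : (μ + ν) * q = (b 0 + b 1) * q := by rw [heq]
    nlinarith

theorem hasLeadingMonomial_of_sub_mem (h : μ * q + ν * (q + 1) < q * (q - 1))
    {f : MvPolynomial (Fin 2) F}
    (hf : f - monomial (expVec μ ν) 1 ∈ weightLT F q (μ * q + ν * (q + 1))) :
    HasLeadingMonomial f μ ν := by
  classical
  rw [mem_weightLT] at hf
  refine ⟨expVec μ ν, ?_, rfl, rfl, fun b hb hne => degRevLexLT_of_wdeg_lt h (hf b ?_)⟩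
  · rw [mem_support_iff]
    intro h0
    refine lt_irrefl _ (hf (expVec μ ν) ?_)
    rw [mem_support_iff, coeff_sub, h0, coeff_monomial, if_pos rfl]
    simp
  · rw [mem_support_iff] at hb ⊢
    rwa [coeff_sub, coeff_monomial, if_neg hne.symm, sub_zero]

theorem HasLeadingMonomial.exists_sub_mem (h : μ * q + ν * (q + 1) < q * (q - 1))
    {f : MvPolynomial (Fin 2) F} (hf : HasLeadingMonomial f μ ν) :
    ∃ c : F, c ≠ 0 ∧
      f - monomial (expVec μ ν) c ∈ weightLT F q (μ * q + ν * (q + 1)) := by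
  classical
  obtain ⟨a, ha, rfl, rfl, hb⟩ := hf
  rw [← eq_expVec]
  refine ⟨coeff a f, mem_support_iff.1 ha, mem_weightLT.2 fun b hb' => ?_⟩
  have hne : b ≠ a := by
    rintro rfl
    simp [coeff_sub] at hb'
  rw [mem_support_iff, coeff_sub, coeff_monomial, if_neg hne.symm, sub_zero] at hb'
  refine wdeg_lt_of_degRevLexLT h ?_
  rw [← eq_expVec]
  exact hb b (mem_support_iff.2 hb') hne

variable {ι : Type*} [Fintype ι] {P : ι → Fin 2 → F}
  (hP : ∀ i, eval (P i) (hermitianPoly F q) = 0)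

include hP

theorem valueSpace_ne_top_of_hasLeadingMonomial (hq : 2 ≤ q) (hinj : Function.Injective P)
    {m : ℕ} (hm : m + 2 = (μ * q + ν * (q + 1)) + q * (q - 1))
    (h0 : 0 < μ * q + ν * (q + 1)) (h : μ * q + ν * (q + 1) < q * (q - 1))
    (hc : Fintype.card ι = μ * q + ν * (q + 1)) {f : MvPolynomial (Fin 2) F}
    (hf : HasLeadingMonomial f μ ν) (hv : ∀ i, eval (P i) f = 0) :
    valueSpace P q (m + 1) ≠ ⊤ := by
  have hw : wdeg q (expVec μ ν) = μ * q + ν * (q + 1) := rfl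
  refine valueSpace_ne_top_of_jumps hP hq hinj hm (hw ▸ isWeight_wdeg hq _) h0 hc fun n hn => ?_
  rw [mem_aperySet hq]
  refine ⟨hn.isWeight hq, ?_⟩
  rintro ⟨h1, h2⟩
  obtain ⟨b, hb⟩ := h2.exists_wdeg
  have hn' : n = wdeg q (b + expVec μ ν) := by rw [wdeg_add, hb, hw]; omega
  rw [hn', isJump_wdeg_iff hP hq] at hn
  obtain ⟨c, hc0, hfc⟩ := hf.exists_sub_mem h
  -- On D, f vanishes, so its lower part scaled by -1/c takes the values of its leading monomial.
  refine hn ⟨monomial b (-c⁻¹) * (f - monomial (expVec μ ν) c), ?_, ?_⟩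
  · rw [wdeg_add, add_comm]
    exact monomial_mul_mem_weightLT hfc b _
  · ext i
    simp only [AlgHom.toLinearMap_apply, evalAt_apply, map_mul, map_sub, hv i, zero_sub, mul_neg]
    rw [← map_mul, monomial_mul, neg_mul, inv_mul_cancel₀ hc0, map_neg, map_neg, neg_neg]

theorem exists_hasLeadingMonomial_of_valueSpace_ne_top (hq : 2 ≤ q) (hinj : Function.Injective P)
    {m : ℕ} (hm : m + 2 = (μ * q + ν * (q + 1)) + q * (q - 1))
    (h : μ * q + ν * (q + 1) < q * (q - 1))
    (hc : Fintype.card ι = μ * q + ν * (q + 1)) (ht : valueSpace P q (m + 1) ≠ ⊤) :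
    ∃ f : MvPolynomial (Fin 2) F, HasLeadingMonomial f μ ν ∧ (∀ i, eval (P i) f = 0) ∧
      ∀ p : MvPolynomial (Fin 2) F, (∀ i, eval (P i) p = 0) →
        p ∈ Ideal.span {hermitianPoly F q, f} := by
  have hj := isJump_iff_of_valueSpace_ne_top hP hq hinj hm ht hc
  have hw : wdeg q (expVec μ ν) = μ * q + ν * (q + 1) := rfl
  have h1 : ¬ IsJump q P (wdeg q (expVec μ ν)) := by
    rw [hj, mem_aperySet hq, hw]
    intro h'
    refine h'.2 ⟨le_rfl, ?_⟩
    rw [Nat.sub_self]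
    exact Nat.zero_mod q ▸ Nat.zero_le _
  rw [isJump_wdeg_iff hP hq, not_not] at h1
  obtain ⟨g, hg, hge⟩ := h1
  have hsub : (monomial (expVec μ ν) 1 - g) - monomial (expVec μ ν) 1 = -g := by ring
  set f : MvPolynomial (Fin 2) F := monomial (expVec μ ν) 1 - g with hfdef
  have hf0 : ∀ i, eval (P i) f = 0 := by
    intro i
    have := congrFun hge i
    simp only [AlgHom.toLinearMap_apply, evalAt_apply] at this
    rw [hfdef, map_sub, this, sub_self]
  refine ⟨f, hasLeadingMonomial_of_sub_mem h (by rw [hsub]; exact neg_mem hg), hf0, ?_⟩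
  have hHI : hermitianPoly F q ∈ Ideal.span {hermitianPoly F q, f} :=
    Ideal.subset_span (by simp)
  have hfI : f ∈ Ideal.span {hermitianPoly F q, f} := Ideal.subset_span (by simp)
  -- Division by induction on weight: a top weight in e+Λ is cancelled by a multiple of f; any other
  -- weight in Λ is a jump, so the top coefficient of a vanishing polynomial is zero there.
  have key : ∀ n, ∀ p ∈ weightLT F q n, (∀ i, eval (P i) p = 0) →
      p ∈ Ideal.span {hermitianPoly F q, f} := by
    intro n
    induction n with
    | zero =>
      intro p hp _
      have : p = 0 := by
        rw [← support_eq_empty, Finset.eq_empty_iff_forall_notMem]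
        exact fun a ha => absurd (mem_weightLT.1 hp a ha) (by omega)
      rw [this]
      exact zero_mem _
    | succ n ih =>
      intro p hp hp0
      by_cases hn : IsWeight q n
      swap
      · rw [weightLT_succ_of_not_isWeight hq hn] at hp
        exact ih p hp hp0
      by_cases hd : μ * q + ν * (q + 1) ≤ n ∧ IsWeight q (n - (μ * q + ν * (q + 1)))
      · obtain ⟨b, hb⟩ := hd.2.exists_wdeg
        have hn' : n = wdeg q (b + expVec μ ν) := by rw [wdeg_add, hb, hw]; omega
        rw [hn'] at hp
        obtain ⟨c, k, hck⟩ := exists_sub_mem_weightLT hq _ hp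
        have e1 : monomial b c * f = monomial (b + expVec μ ν) c - monomial b c * g := by
          rw [hfdef, mul_sub, monomial_mul, mul_one]
        have hmem : p - monomial b c * f - hermitianPoly F q * k ∈ weightLT F q n := by
          have : p - monomial b c * f - hermitianPoly F q * k =
              (p - monomial (b + expVec μ ν) c - hermitianPoly F q * k) + monomial b c * g := by
            rw [e1]; ring
          rw [this, hn']
          refine add_mem hck ?_
          rw [wdeg_add, add_comm (wdeg q b)]
          exact monomial_mul_mem_weightLT hg b c
        have := ih _ hmem fun i => by simp [hP i, hf0 i, hp0 i]
        have h2 := add_mem (add_mem this (Ideal.mul_mem_right k _ hHI))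
          (Ideal.mul_mem_left _ (monomial b c) hfI)
        convert h2 using 1
        ring
      · have hJ : IsJump q P n := (hj n).2 ((mem_aperySet hq).2 ⟨hn, hd⟩)
        obtain ⟨b, rfl⟩ := hn.exists_wdeg
        rw [isJump_wdeg_iff hP hq] at hJ
        obtain ⟨c, k, hck⟩ := exists_sub_mem_weightLT hq _ hp
        have hc0 : c = 0 := by
          by_contra hc0
          refine hJ ⟨(-c⁻¹) • (p - monomial b c - hermitianPoly F q * k),
            Submodule.smul_mem _ _ hck, ?_⟩
          ext i
          simp [hP i, hp0 i, eval_monomial, hc0]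
        rw [hc0, map_zero, sub_zero] at hck
        have := ih _ hck fun i => by simp [hP i, hp0 i]
        convert add_mem this (Ideal.mul_mem_right k _ hHI) using 1
        ring
  intro p
  obtain ⟨n, hn⟩ := exists_mem_weightLT (q := q) p
  exact key n p hn

end LeadingMonomial

/-! ### Codewords -/

section Codewords

variable {F : Type*} [Field F] [Fintype F] {q : ℕ}

theorem mem_code {m : ℕ} {c : RatPoint F q → F} :
    c ∈ code F q m ↔ ∀ p ∈ weightLT F q (m + 1), ∑ P : RatPoint F q, eval P.1 p * c P = 0 := by
  constructor
  · intro h p hp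
    have := h _ ⟨p, hp, rfl⟩
    simpa [dotProduct, evalMap, aeval_eq_eval] using this
  · rintro h _ ⟨p, hp, rfl⟩
    simpa [dotProduct, evalMap, aeval_eq_eval] using h p hp

/-- Codewords supported in D are the linear functionals on F^D that kill the space of values; a
nonzero one exists iff that space is proper. -/
theorem exists_codeword_iff (D : Finset (RatPoint F q)) (m : ℕ) :
    (∃ c ∈ code F q m, c ≠ 0 ∧ Function.support c ⊆ (D : Set (RatPoint F q))) ↔
      valueSpace (fun P : D => P.1.1) q (m + 1) ≠ ⊤ := by
  classical
  constructor
  · rintro ⟨c, hc, hc0, hs⟩ ht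
    obtain ⟨P, hPc⟩ := Function.ne_iff.1 hc0
    have hPD : P ∈ D := hs hPc
    have hmem : (Pi.single ⟨P, hPD⟩ 1 : D → F) ∈
        valueSpace (fun P : D => P.1.1) q (m + 1) := ht ▸ Submodule.mem_top
    obtain ⟨p, hp, hpe⟩ := hmem
    have h0 := mem_code.1 hc p hp
    rw [Finset.sum_eq_single P] at h0
    · have := congrFun hpe ⟨P, hPD⟩
      simp only [AlgHom.toLinearMap_apply, evalAt_apply, Pi.single_eq_same] at this
      rw [this, one_mul] at h0
      exact hPc h0
    · intro Q _ hQ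
      by_cases hQD : Q ∈ D
      · have := congrFun hpe ⟨Q, hQD⟩
        rw [Pi.single_eq_of_ne (by simpa using hQ)] at this
        simp only [AlgHom.toLinearMap_apply, evalAt_apply] at this
        rw [this, zero_mul]
      · have : c Q = 0 := by
          by_contra hcQ
          exact hQD (hs hcQ)
        rw [this, mul_zero]
    · simp
  · intro ht
    obtain ⟨φ, hφ, hle⟩ := Submodule.exists_le_ker_of_lt_top _ (lt_top_iff_ne_top.2 ht)
    have hφe : ∀ v : D → F, φ v = ∑ i, v i * φ (Pi.single i 1) := by
      intro v
      conv_lhs => rw [pi_eq_sum_univ' v]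
      rw [map_sum]
      refine Finset.sum_congr rfl fun i _ => ?_
      rw [map_smul, smul_eq_mul]
    refine ⟨fun P => if h : P ∈ D then φ (Pi.single ⟨P, h⟩ 1) else 0, ?_, ?_, ?_⟩
    · rw [mem_code]
      intro p hp
      have h0 : φ (evalAt (fun P : D => P.1.1) p) = 0 := hle ⟨p, hp, rfl⟩
      rw [hφe] at h0
      refine Eq.trans ?_ h0
      rw [← Finset.sum_subset (Finset.subset_univ D), ← Finset.sum_coe_sort D]
      · refine Finset.sum_congr rfl fun i _ => ?_
        simp
      · intro P _ hPD
        simp [hPD]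
    · intro hc
      refine hφ (LinearMap.ext fun v => ?_)
      rw [hφe]
      refine Finset.sum_eq_zero fun i _ => ?_
      have := congrFun hc i.1
      simp only [i.2, dite_true, Pi.zero_apply] at this
      rw [this, mul_zero]
    · intro P hPc
      by_contra hPD
      exact hPc (dif_neg hPD)

omit [Fintype F] in
theorem eval_eq_zero_of_ratPoint (D : Finset (RatPoint F q)) (P : D) :
    eval P.1.1 (hermitianPoly F q) = 0 := P.1.2

omit [Fintype F] in
theorem injective_ratPoint (D : Finset (RatPoint F q)) :
    Function.Injective fun P : D => P.1.1 :=
  Subtype.val_injective.comp Subtype.val_injective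

/-- The Goppa bound applied to the support of any nonzero codeword gives weight at least |D|, so a
nonzero codeword supported in D fills D and is minimal. -/
theorem supportsMinWeight_iff (hq : 2 ≤ q) {m : ℕ} {D : Finset (RatPoint F q)}
    (hm : m + 2 = D.card + q * (q - 1)) :
    SupportsMinWeight (code F q m) D ↔ valueSpace (fun P : D => P.1.1) q (m + 1) ≠ ⊤ := by
  classical
  have bound : ∀ c ∈ code F q m, c ≠ 0 →
      D.card ≤ (Finset.univ.filter fun P => c P ≠ 0).card := by
    intro c hc hc0
    have := (exists_codeword_iff (Finset.univ.filter fun P => c P ≠ 0) m).1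
      ⟨c, hc, hc0, fun P hP => by simpa using hP⟩
    exact (le_card_of_valueSpace_ne_top (eval_eq_zero_of_ratPoint _) hq
      (injective_ratPoint _) hm this).trans (Fintype.card_coe _).le
  rw [← exists_codeword_iff]
  constructor
  · rintro ⟨c, ⟨hc, hc0, -⟩, hs⟩
    exact ⟨c, hc, hc0, hs.le⟩
  · rintro ⟨c, hc, hc0, hs⟩
    have hsub : (Finset.univ.filter fun P => c P ≠ 0) ⊆ D := fun P hP =>
      hs (Finset.mem_filter.1 hP).2
    have heq := Finset.eq_of_subset_of_card_le hsub (bound c hc hc0)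
    refine ⟨c, ⟨hc, hc0, fun c' hc' hc0' => ?_⟩, ?_⟩
    · have := bound c' hc' hc0'
      rw [← heq] at this
      unfold hammingNorm
      convert this
    · rw [← heq]
      ext P
      simp

omit [Fintype F] in
theorem IsSchemeIntersection.isSetIntersection {D : Finset (RatPoint F q)}
    {f : MvPolynomial (Fin 2) F} (h : IsSchemeIntersection D f) : IsSetIntersection D f := by
  classical
  unfold IsSchemeIntersection at h
  have hf : f ∈ vanishingIdeal F (planePoints D) := h ▸ Ideal.subset_span (by simp)
  ext Q
  constructor
  · rintro ⟨_, ⟨P, hP, rfl⟩, rfl⟩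
    have key : ∀ p : MvPolynomial (Fin 2) F, eval P.1 p = 0 →
        aeval (fun i => algebraMap F (AlgebraicClosure F) (P.1 i)) p = 0 := by
      intro p hp
      have := aeval_algebraMap_apply (AlgebraicClosure F) P.1 p
      rw [aeval_eq_eval] at this
      exact this.trans (by simp [hp])
    refine ⟨key _ P.2, key _ ?_⟩
    have := (mem_vanishingIdeal_iff.1 hf) P.1 ⟨P, hP, rfl⟩
    simpa [aeval_eq_eval] using this
  · rintro ⟨hQ1, hQ2⟩
    have hQ : ∀ p ∈ vanishingIdeal F (planePoints D), aeval Q p = 0 := by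
      rw [h]
      intro p hp
      obtain ⟨a, b, rfl⟩ := Ideal.mem_span_pair.1 hp
      simp [hQ1, hQ2]
    by_contra hc
    have : ∀ P ∈ D, ∃ i, Q i ≠ algebraMap F (AlgebraicClosure F) (P.1 i) := by
      intro P hP
      by_contra! hcP
      exact hc ⟨P.1, ⟨P, hP, rfl⟩, (funext hcP).symm⟩
    choose! k hk using this
    -- This product vanishes on D but not at Q if Q lies off D.
    have hz := hQ (∏ P ∈ D, (X (k P) - C (P.1 (k P)))) (mem_vanishingIdeal_iff.2 ?_)
    · rw [map_prod] at hz
      obtain ⟨P, hP, h0⟩ := Finset.prod_eq_zero_iff.1 hz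
      rw [map_sub, aeval_X, ← algebraMap_eq, AlgHom.commutes, sub_eq_zero] at h0
      exact hk P hP h0
    · rintro _ ⟨P, hP, rfl⟩
      rw [map_prod]
      exact Finset.prod_eq_zero hP (by simp)

omit [Fintype F] in
theorem IsSetIntersection.eval_eq_zero {D : Finset (RatPoint F q)}
    {f : MvPolynomial (Fin 2) F} (h : IsSetIntersection D f) {P : RatPoint F q} (hP : P ∈ D) :
    eval P.1 f = 0 := by
  have := (Set.ext_iff.1 h _).1 ⟨P.1, ⟨P, hP, rfl⟩, rfl⟩
  have h2 := this.2
  have h3 := aeval_algebraMap_apply (AlgebraicClosure F) P.1 f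
  rw [aeval_eq_eval] at h3
  exact (algebraMap F (AlgebraicClosure F)).injective (by rw [map_zero]; exact h3.symm.trans h2)

end Codewords

end HermitianCode

theorem mainTheorem4 {F : Type*} [Field F] [Fintype F] (q : ℕ) (hq : IsPrimePow q)
    (hF : Fintype.card F = q ^ 2) (m : ℕ)
    (hm₁ : (q : ℤ) ^ 2 - q - 1 ≤ m) (hm₂ : (m : ℤ) ≤ 2 * q ^ 2 - 2 * q - 3)
    (hm : m = HermitianCode.mTilde q m)
    (μ ν : ℕ) (hδ : HermitianCode.deltaTilde q m = μ * q + ν * (q + 1))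
    (D : Finset (HermitianCode.RatPoint F q))
    (hD : (D.card : ℤ) = HermitianCode.deltaTilde q m) :
    (HermitianCode.SupportsMinWeight (HermitianCode.code F q m) D ↔
      ∃ f : MvPolynomial (Fin 2) F,
        HermitianCode.HasLeadingMonomial f μ ν ∧ HermitianCode.IsSchemeIntersection D f) ∧
    (HermitianCode.SupportsMinWeight (HermitianCode.code F q m) D ↔
      ∃ f : MvPolynomial (Fin 2) F,
        HermitianCode.HasLeadingMonomial f μ ν ∧ HermitianCode.IsSetIntersection D f) := by
  open HermitianCode MvPolynomial in
  have hq2 : 2 ≤ q := hq.two_le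
  have hcz : ((q * (q - 1) : ℕ) : ℤ) = (q : ℤ) ^ 2 - q := by
    rw [Nat.cast_mul, Nat.cast_sub (by omega)]
    push_cast
    ring
  have hδm : deltaTilde q m = (m : ℤ) - (q - 2) * (q + 1) := by
    rw [deltaTilde, ← hm, delta]
  have hδ' : deltaTilde q m = (m : ℤ) - (q ^ 2 - q) + 2 := by rw [hδm]; ring
  have hDμ : D.card = μ * q + ν * (q + 1) := by
    rw [hδ] at hD
    exact_mod_cast hD
  have hmD : m + 2 = D.card + q * (q - 1) := by
    zify
    push_cast at hcz ⊢
    linarith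
  -- The lower bound on m gives δ ≥ 1; the upper bound gives δ < q(q-1) below.
  have hD0 : 0 < D.card := by
    zify
    linarith
  have hlt : μ * q + ν * (q + 1) < q * (q - 1) := by
    rw [← hDμ]
    zify
    push_cast at hcz ⊢
    linarith
  have hmμ : m + 2 = (μ * q + ν * (q + 1)) + q * (q - 1) := by rw [← hDμ]; exact hmD
  have hcard : Fintype.card D = μ * q + ν * (q + 1) := by rw [Fintype.card_coe, hDμ]
  have hP := eval_eq_zero_of_ratPoint D
  have hinj := injective_ratPoint D
  have hsm := supportsMinWeight_iff hq2 hmD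
  have scheme : SupportsMinWeight (code F q m) D →
      ∃ f : MvPolynomial (Fin 2) F, HasLeadingMonomial f μ ν ∧ IsSchemeIntersection D f := by
    intro h
    obtain ⟨f, hf, hf0, hI⟩ := exists_hasLeadingMonomial_of_valueSpace_ne_top hP hq2 hinj hmμ hlt
      hcard (hsm.1 h)
    refine ⟨f, hf, le_antisymm (fun p hp => hI p fun P => ?_) (Ideal.span_le.2 ?_)⟩
    · simpa [aeval_eq_eval] using mem_vanishingIdeal_iff.1 hp P.1.1 ⟨P.1, P.2, rfl⟩
    · rintro p (rfl | rfl)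
      · refine mem_vanishingIdeal_iff.2 ?_
        rintro _ ⟨P, _, rfl⟩
        simpa [aeval_eq_eval] using P.2
      · refine mem_vanishingIdeal_iff.2 ?_
        rintro _ ⟨P, hPD, rfl⟩
        simpa [aeval_eq_eval] using hf0 ⟨P, hPD⟩
  -- Only the vanishing of f on D is used, so the weaker set-theoretic reading suffices and closes
  -- the cycle of implications.
  have back : (∃ f : MvPolynomial (Fin 2) F, HasLeadingMonomial f μ ν ∧ IsSetIntersection D f) →
      SupportsMinWeight (code F q m) D := by
    rintro ⟨f, hf, hI⟩
    exact hsm.2 (valueSpace_ne_top_of_hasLeadingMonomial hP hq2 hinj hmμ (hDμ ▸ hD0) hlt hcard hf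
      fun P => hI.eval_eq_zero P.2)
  exact ⟨⟨scheme, fun ⟨f, hf, hI⟩ => back ⟨f, hf, hI.isSetIntersection⟩⟩,
    ⟨fun h => (scheme h).imp fun _ hf => ⟨hf.1, hf.2.isSetIntersection⟩, back⟩⟩
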